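/- Let $m\ge 2$, $n\ge 1$, let $\mathcal A=(A_{i_1\cdots i_m})$ be a real tensor of order $m$ and dimension $n$ with nonnegative entries, and let $a,b\in\mathbb R^n$ have positive entries. For a tensor $\mathcal B$ of order $m$ and dimension $n$ and a vector $x$, put $(\mathcal Bx^{m-1})_i=\sum_{i_2,\dots,i_m}B_{ii_2\cdots i_m}x_{i_2}\cdots x_{i_m}$ and $x^{[m-1]}=(x_1^{m-1},\dots,x_n^{m-1})^T$. An eigenpair of $\mathcal B$ is a pair $(\lambda,x)\in\mathbb C\times(\mathbb C^n\setminus\{0\})$ with $\mathcal Bx^{m-1}=\lambda x^{[m-1]}$; $\lambda$ is then called an eigenvalue. A Perron pair of $\mathcal B$ is an eigenpair $(\lambda_*,x_*)$ such that $\lambda_*$ is the maximum of $|\lambda|$ over all (complex) eigenvalues $\lambda$ of $\mathcal B$ and $x_*$ is a real vector with nonnegative entries and $x_*^Tx_*=1$. The tensor $\mathcal B$ is reducible if there is a nonempty proper subset $I\subset\{1,\dots,n\}$ with $B_{i_1\cdots i_m}=0$ for all $i_1\in I$ and $i_2,\dots,i_m\notin I$, and irreducible otherwise. Let $\mathcal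 E=a^{[m-1]}\circ b\circ\cdots\circ b$, i.e. $E_{i_1\cdots i_m}=a_{i_1}^{m-1}b_{i_2}\cdots b_{i_m}$, and for $\lambda\in\mathbb R$, $x\in\mathbb R^n$, $t\in[0,1]$ let $$Q(\lambda,x)=\begin{pmatrix}\mathcal Ex^{m-1}-\lambda x^{[m-1]}\\ x^Tx-1\end{pmatrix},\quad P(\lambda,x)=\begin{pmatrix}\mathcal Ax^{m-1}-\lambda x^{[m-1]}\\ x^Tx-1\end{pmatrix},\quad H(\lambda,x,t)=(1-t)Q(\lambda,x)+tP(\lambda,x).$$ **Theorem 2.1.** For every $t\in[0,1)$ the equation $H(\lambda,x,t)=0$ has exactly one solution $(\lambda(t),x(t))$ with $\lambda(t)>0$ and all entries of $x(t)$ positive. The resulting curve $t\mapsto(\lambda(t),x(t))$ is $C^\infty$ on $[0,1)$ and starts at $(\lambda(0),x(0))=\left((a^Tb)^{m-1},\,a/\|a\|\right)$, where $\|\cdot\|$ is the Euclidean norm, which is the unique Perron pair of $\mathcal E$. The curve has at least one limit point as $t\to1^-$, and every limit point $(\lambda,x)$ of it as $t\to 1^-$ is a nonnegative normalized eigenpair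 of $\mathcal A$: $\lambda\ge0$, $x$ has nonnegative entries, $x^Tx=1$ and $\mathcal Ax^{m-1}=\lambda x^{[m-1]}$. If furthermore $\mathcal A$ is irreducible, then $\mathcal A$ has a unique Perron pair $(\lambda_*,x_*)$, and $\lim_{t\to1^-}(\lambda(t),x(t))=(\lambda_*,x_*)$. -/

import Mathlib

open Set Filter Topology
open scoped Matrix ContDiff

/-- Real tensors of order `m` and dimension `n` (used for `m ≥ 2`). The entry with indices
`(i₁, i₂, …, i_m)` is `A i₁ j`, where `j = (i₂, …, i_m)` is the tuple of the last `m - 1` indices. -/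
abbrev RealTensor (m n : ℕ) : Type := Fin n → (Fin (m - 1) → Fin n) → ℝ

namespace RealTensor

/-- The vector `A x^{m-1}`, for `x` with coordinates in `K` (used for `K = ℝ` and `K = ℂ`):
its `i`-th entry is the sum of `A_{i i₂ … i_m} x_{i₂} ⋯ x_{i_m}` over all `i₂, …, i_m`. -/
def apply {m n : ℕ} {K : Type} [CommRing K] [Algebra ℝ K]
    (A : RealTensor m n) (x : Fin n → K) : Fin n → K :=
  fun i => ∑ j : Fin (m - 1) → Fin n, A i j • ∏ k, x (j k)

/-- `(lam, x)` is an eigenpair of `A`: `x ≠ 0` and `A x^{m-1} = lam x^{[m-1]}`. -/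
def IsEigenpair {m n : ℕ} {K : Type} [CommRing K] [Algebra ℝ K]
    (A : RealTensor m n) (lam : K) (x : Fin n → K) : Prop :=
  x ≠ 0 ∧ A.apply x = fun i => lam * x i ^ (m - 1)

/-- All entries are nonnegative. -/
def IsNonneg {m n : ℕ} (A : RealTensor m n) : Prop := ∀ i j, 0 ≤ A i j

/-- There is a nonempty proper set `I` of indices such that `A_{i₁ i₂ … i_m} = 0` whenever
`i₁ ∈ I` and `i₂, …, i_m ∉ I`. -/
def IsReducible {m n : ℕ} (A : RealTensor m n) : Prop :=
  ∃ I : Set (Fin n), I.Nonempty ∧ I ≠ univ ∧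
    ∀ i ∈ I, ∀ j : Fin (m - 1) → Fin n, (∀ k, j k ∉ I) → A i j = 0

/-- `r` is the spectral radius of `A`: the maximum of the moduli of its complex eigenvalues. -/
def IsSpectralRadius {m n : ℕ} (A : RealTensor m n) (r : ℝ) : Prop :=
  IsGreatest {s : ℝ | ∃ (mu : ℂ) (y : Fin n → ℂ), A.IsEigenpair mu y ∧ s = ‖mu‖} r

/-- `p = (lam, x)` is a real eigenpair with `lam ≥ 0`, `x ≥ 0` entrywise and `xᵀ x = 1`. -/
def IsNonnegUnitEigenpair {m n : ℕ} (A : RealTensor m n) (p : ℝ × (Fin n → ℝ)) : Prop :=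
  A.IsEigenpair p.1 p.2 ∧ 0 ≤ p.1 ∧ (∀ i, 0 ≤ p.2 i) ∧ p.2 ⬝ᵥ p.2 = 1

/-- `p = (lam, x)` is a Perron pair of `A`: `lam` is the spectral radius and `x` is a
nonnegative eigenvector for `lam`, normalized by `xᵀ x = 1`. -/
def IsPerronPair {m n : ℕ} (A : RealTensor m n) (p : ℝ × (Fin n → ℝ)) : Prop :=
  A.IsSpectralRadius p.1 ∧ A.IsNonnegUnitEigenpair p

/-- The tensor `a^{[m-1]} ∘ b ∘ ⋯ ∘ b`, with entries `a_{i₁}^{m-1} b_{i₂} ⋯ b_{i_m}`. -/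
def start (m : ℕ) {n : ℕ} (a b : Fin n → ℝ) : RealTensor m n :=
  fun i j => a i ^ (m - 1) * ∏ k, b (j k)

/-- The normalized eigenvalue system `(A x^{m-1} - lam x^{[m-1]}, xᵀ x - 1)`. -/
def eigenSystem {m n : ℕ} (A : RealTensor m n) (p : ℝ × (Fin n → ℝ)) : (Fin n → ℝ) × ℝ :=
  (fun i => A.apply p.2 i - p.1 * p.2 i ^ (m - 1), p.2 ⬝ᵥ p.2 - 1)

/-- The homotopy `H = (1 - t) Q + t P` between the eigenvalue system `Q` of
`a^{[m-1]} ∘ b ∘ ⋯ ∘ b` and the eigenvalue system `P` of `A`. -/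
def homotopy {m n : ℕ} (A : RealTensor m n) (a b : Fin n → ℝ)
    (p : ℝ × (Fin n → ℝ)) (t : ℝ) : (Fin n → ℝ) × ℝ :=
  (1 - t) • (start m a b).eigenSystem p + t • A.eigenSystem p

/-- `p = (lam, x)` is an entrywise positive solution of `H(lam, x, t) = 0`. -/
def IsPositiveSolution {m n : ℕ} (A : RealTensor m n) (a b : Fin n → ℝ)
    (t : ℝ) (p : ℝ × (Fin n → ℝ)) : Prop :=
  0 < p.1 ∧ (∀ i, 0 < p.2 i) ∧ A.homotopy a b p t = 0

end RealTensor

namespace RealTensor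

/-! The eigenvalue system is affine in the tensor, so `H(·, t)` is the system of one tensor `blend A
a b t`, whose entries are positive for `t < 1`. The theorem is then nonlinear Perron–Frobenius
theory for this family.

Existence: among unit `x ≥ 0` with `B x^{m-1} ≤ lam x^{[m-1]}`, the least `lam` is attained at an
eigenpair (`exists_pos_unit_eigenpair`). Uniqueness: scale one positive eigenvector until it touches
another from above and compare at the point of contact (`unit_eigenpair_unique`); the same
comparison bounds the moduli of all complex eigenvalues (`isPerronPair`).

Smoothness: a maximum principle makes the linearization injective, so the implicit function theorem
gives a local smooth branch, which is the curve by uniqueness.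

As `t → 1` the curve stays in a compact set, so limit points exist, and they solve `H(·, 1) = 0` by
continuity. If `A` is irreducible, it has at most one nonnegative unit eigenpair; hence there is one
limit point, which supplies the Perron pair and forces convergence. -/

variable {m n : ℕ}

/-! ### Homogeneity, monotonicity and positivity of `x ↦ A x^{m-1}` -/

theorem apply_real (A : RealTensor m n) (x : Fin n → ℝ) (i : Fin n) :
    A.apply x i = ∑ j : Fin (m - 1) → Fin n, A i j * ∏ k, x (j k) := rfl

theorem apply_smul (A : RealTensor m n) (c : ℝ) (x : Fin n → ℝ) (i : Fin n) :
    A.apply (c • x) i = c ^ (m - 1) * A.apply x i := by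
  simp only [apply_real, Finset.mul_sum, Pi.smul_apply, smul_eq_mul, Finset.prod_mul_distrib,
    Finset.prod_const, Finset.card_univ, Fintype.card_fin]
  exact Finset.sum_congr rfl fun j _ => by ring

theorem IsNonneg.apply_nonneg {A : RealTensor m n} (hA : A.IsNonneg) {x : Fin n → ℝ}
    (hx : ∀ i, 0 ≤ x i) (i : Fin n) : 0 ≤ A.apply x i :=
  Finset.sum_nonneg fun j _ => mul_nonneg (hA i j) (Finset.prod_nonneg fun k _ => hx (j k))

theorem IsNonneg.apply_mono {A : RealTensor m n} (hA : A.IsNonneg) {x y : Fin n → ℝ}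
    (hx : ∀ i, 0 ≤ x i) (hxy : ∀ i, x i ≤ y i) (i : Fin n) : A.apply x i ≤ A.apply y i :=
  Finset.sum_le_sum fun j _ => mul_le_mul_of_nonneg_left
    (Finset.prod_le_prod (fun k _ => hx (j k)) fun k _ => hxy (j k)) (hA i j)

theorem IsNonneg.norm_apply_le {A : RealTensor m n} (hA : A.IsNonneg) (y : Fin n → ℂ)
    (i : Fin n) : ‖A.apply y i‖ ≤ A.apply (fun k => ‖y k‖) i := by
  refine (norm_sum_le _ _).trans (Finset.sum_le_sum fun j _ => ?_)
  rw [norm_smul, norm_prod, Real.norm_of_nonneg (hA i j), smul_eq_mul]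

theorem apply_ofReal (A : RealTensor m n) (x : Fin n → ℝ) (i : Fin n) :
    A.apply (fun k => (x k : ℂ)) i = ((A.apply x i : ℝ) : ℂ) := by
  simp [apply, Algebra.smul_def]

/-- The entries of a tensor with positive entries, evaluated at a nonzero nonnegative vector,
are positive. -/
theorem apply_pos {B : RealTensor m n} (hB : ∀ i j, 0 < B i j) {x : Fin n → ℝ}
    (hx : ∀ i, 0 ≤ x i) (hx0 : x ≠ 0) (i : Fin n) : 0 < B.apply x i := by
  obtain ⟨l, hl⟩ := Function.ne_iff.1 hx0
  have hl' : 0 < x l := (hx l).lt_of_ne' hl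
  refine Finset.sum_pos' (fun j _ => mul_nonneg (hB i j).le
    (Finset.prod_nonneg fun k _ => hx (j k))) ⟨fun _ => l, Finset.mem_univ _, ?_⟩
  exact mul_pos (hB i _) (Finset.prod_pos fun _ _ => hl')

/-- If `x l < y l`, the term of the constant tuple `l, …, l` grows strictly; it is nonempty because
`m ≥ 2`. -/
theorem apply_strictMono {B : RealTensor m n} (hm : 2 ≤ m) (hB : ∀ i j, 0 < B i j)
    {x y : Fin n → ℝ} (hx : ∀ i, 0 ≤ x i) (hxy : ∀ i, x i ≤ y i) (hne : x ≠ y) (i : Fin n) :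
    B.apply x i < B.apply y i := by
  obtain ⟨l, hl⟩ := Function.ne_iff.1 hne
  have hl' : x l < y l := (hxy l).lt_of_ne hl
  refine Finset.sum_lt_sum (fun j _ => mul_le_mul_of_nonneg_left
    (Finset.prod_le_prod (fun k _ => hx (j k)) fun k _ => hxy (j k)) (hB i j).le)
    ⟨fun _ => l, Finset.mem_univ _, ?_⟩
  refine mul_lt_mul_of_pos_left ?_ (hB i _)
  simp only [Finset.prod_const, Finset.card_univ, Fintype.card_fin]
  exact pow_lt_pow_left₀ hl' (hx l) (by omega)

theorem not_isReducible_of_pos {B : RealTensor m n} (hB : ∀ i j, 0 < B i j) :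
    ¬ B.IsReducible := by
  rintro ⟨I, ⟨i, hi⟩, hI, h⟩
  obtain ⟨l, hl⟩ := (ne_univ_iff_exists_notMem I).1 hI
  exact (hB i fun _ => l).ne' (h i hi _ fun _ => hl)

/-! ### Comparison, uniqueness and the Perron pair -/

/-- There is a largest ratio between the entries of a nonnegative and a positive vector. -/
theorem exists_max_ratio {x y : Fin n → ℝ} (hx : ∀ i, 0 < x i) (hy : ∀ i, 0 ≤ y i)
    (hy0 : y ≠ 0) : ∃ (s : ℝ) (i : Fin n), 0 < s ∧ y i = s * x i ∧ ∀ k, y k ≤ s * x k := by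
  obtain ⟨l, hl⟩ := Function.ne_iff.1 hy0
  have hl' : 0 < y l := (hy l).lt_of_ne' hl
  obtain ⟨i, -, hi⟩ := Finset.exists_max_image Finset.univ (fun i => y i / x i)
    ⟨l, Finset.mem_univ _⟩
  refine ⟨y i / x i, i, (div_pos hl' (hx l)).trans_le (hi l (Finset.mem_univ _)), ?_, fun k => ?_⟩
  · rw [div_mul_cancel₀ _ (hx i).ne']
  · exact (div_le_iff₀ (hx k)).1 (hi k (Finset.mem_univ _))

/-- Comparison with a positive eigenvector. -/
theorem IsNonneg.le_of_subeigenvector {A : RealTensor m n} (hA : A.IsNonneg) {lam mu : ℝ}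
    {x y : Fin n → ℝ} (hx : ∀ i, 0 < x i) (hxA : ∀ i, A.apply x i = lam * x i ^ (m - 1))
    (hy : ∀ i, 0 ≤ y i) (hy0 : y ≠ 0) (hyA : ∀ i, mu * y i ^ (m - 1) ≤ A.apply y i) :
    mu ≤ lam := by
  -- `s • x` is the least multiple of `x` above `y` and touches it at `i`, where `mu * y i ^ (m - 1)
  -- ≤ A.apply y i ≤ A.apply (s • x) i = lam * y i ^ (m - 1)`.
  obtain ⟨s, i, hs, hi, hle⟩ := exists_max_ratio hx hy hy0
  have h1 := (hyA i).trans (hA.apply_mono hy (y := s • x) hle i)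
  rw [apply_smul, hxA, hi, mul_pow] at h1
  have h2 : 0 < s ^ (m - 1) * x i ^ (m - 1) := mul_pos (pow_pos hs _) (pow_pos (hx i) _)
  exact le_of_mul_le_mul_right (by linarith) h2

/-- A nonnegative eigenvector of an irreducible nonnegative tensor is positive. -/
theorem IsNonneg.eigenvector_pos {A : RealTensor m n} (hm : 2 ≤ m) (hA : A.IsNonneg)
    (hirr : ¬ A.IsReducible) {lam : ℝ} {x : Fin n → ℝ} (hx : ∀ i, 0 ≤ x i) (hx0 : x ≠ 0)
    (hxA : ∀ i, A.apply x i = lam * x i ^ (m - 1)) (i : Fin n) : 0 < x i := by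
  by_contra hi
  -- The zero set of `x` would reduce `A`: on it the sum `A.apply x i` of nonnegative terms
  -- vanishes, so every entry whose remaining indices all lie in the support is zero.
  refine hirr ⟨{i | x i = 0}, ⟨i, le_antisymm (not_lt.1 hi) (hx i)⟩, fun h => hx0 ?_, ?_⟩
  · exact funext fun k => by simpa using h.ge (mem_univ k)
  · intro i hi j hj
    have h1 := hxA i
    rw [show x i = 0 from hi, zero_pow (by omega), mul_zero, apply_real] at h1
    have h2 := (Finset.sum_eq_zero_iff_of_nonneg fun j _ => mul_nonneg (hA i j)
      (Finset.prod_nonneg fun k _ => hx (j k))).1 h1 j (Finset.mem_univ _)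
    exact (mul_eq_zero.1 h2).resolve_right (Finset.prod_ne_zero_iff.2 fun k _ => hj k)

/-- Positive eigenvectors of an irreducible nonnegative tensor for the same eigenvalue are
proportional. -/
theorem IsNonneg.eigenvector_proportional {A : RealTensor m n} (hm : 2 ≤ m) (hA : A.IsNonneg)
    (hirr : ¬ A.IsReducible) {lam : ℝ} {x y : Fin n → ℝ} (hx : ∀ i, 0 < x i)
    (hxA : ∀ i, A.apply x i = lam * x i ^ (m - 1)) (hy : ∀ i, 0 < y i) (hy0 : y ≠ 0)
    (hyA : ∀ i, A.apply y i = lam * y i ^ (m - 1)) : ∃ s : ℝ, 0 < s ∧ y = s • x := by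
  obtain ⟨s, i₀, hs, hi₀, hle⟩ := exists_max_ratio hx (fun i => (hy i).le) hy0
  refine ⟨s, hs, ?_⟩
  by_contra hne
  -- The contact set would reduce `A`: a nonzero entry with `i` in it and all of `j` outside gives
  -- `A.apply y i < A.apply (s • x) i`, although both sides equal `lam * y i ^ (m - 1)`.
  refine hirr ⟨{i | y i = s * x i}, ⟨i₀, hi₀⟩, fun h => hne ?_, ?_⟩
  · exact funext fun k => h.ge (mem_univ k)
  · intro i hi j hj
    have hi' : y i = s * x i := hi
    by_contra hA0
    have hpos : 0 < A i j := (hA i j).lt_of_ne' hA0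
    have h1 : A.apply y i < A.apply (s • x) i := by
      refine Finset.sum_lt_sum (fun j _ => mul_le_mul_of_nonneg_left
        (Finset.prod_le_prod (fun k _ => (hy (j k)).le) fun k _ => hle (j k)) (hA i j))
        ⟨j, Finset.mem_univ _, mul_lt_mul_of_pos_left ?_ hpos⟩
      have : Nonempty (Fin (m - 1)) := ⟨⟨0, by omega⟩⟩
      exact Finset.prod_lt_prod_of_nonempty (fun k _ => hy (j k))
        (fun k _ => (hle (j k)).lt_of_ne (hj k)) Finset.univ_nonempty
    rw [apply_smul, hxA, hyA, hi', mul_pow] at h1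
    exact h1.ne (by ring)

theorem ne_zero_of_dotProduct_eq_one {x : Fin n → ℝ} (hx : x ⬝ᵥ x = 1) : x ≠ 0 := by
  rintro rfl
  simp at hx

/-- An irreducible nonnegative tensor has at most one nonnegative unit eigenpair. -/
theorem IsNonneg.unit_eigenpair_unique {A : RealTensor m n} (hm : 2 ≤ m) (hA : A.IsNonneg)
    (hirr : ¬ A.IsReducible) {p q : ℝ × (Fin n → ℝ)} (hp : A.IsNonnegUnitEigenpair p)
    (hq : A.IsNonnegUnitEigenpair q) : p = q := by
  obtain ⟨lam, x⟩ := p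
  obtain ⟨mu, y⟩ := q
  obtain ⟨⟨hx0, hxA⟩, -, hx, hx1⟩ := hp
  obtain ⟨⟨hy0, hyA⟩, -, hy, hy1⟩ := hq
  simp only at hx0 hxA hx hx1 hy0 hyA hy hy1
  have hxA := congr_fun hxA
  have hyA := congr_fun hyA
  have hx' := hA.eigenvector_pos hm hirr hx hx0 hxA
  have hy' := hA.eigenvector_pos hm hirr hy hy0 hyA
  obtain rfl : lam = mu := le_antisymm
    (hA.le_of_subeigenvector hy' hyA hx hx0 fun i => (hxA i).ge)
    (hA.le_of_subeigenvector hx' hxA hy hy0 fun i => (hyA i).ge)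
  obtain ⟨s, hs, rfl⟩ := hA.eigenvector_proportional hm hirr hx' hxA hy' hy0 hyA
  rw [smul_dotProduct, dotProduct_smul, hx1, smul_eq_mul, smul_eq_mul, mul_one] at hy1
  obtain rfl : s = 1 := by nlinarith
  rw [one_smul]

/-- A nonnegative unit eigenpair of an irreducible nonnegative tensor is a Perron pair. -/
theorem IsNonneg.isPerronPair {A : RealTensor m n} (hm : 2 ≤ m) (hA : A.IsNonneg)
    (hirr : ¬ A.IsReducible) {p : ℝ × (Fin n → ℝ)} (hp : A.IsNonnegUnitEigenpair p) :
    A.IsPerronPair p := by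
  refine ⟨⟨⟨p.1, fun k => p.2 k, ⟨?_, funext fun i => ?_⟩, ?_⟩, ?_⟩, hp⟩
  · intro h
    exact hp.1.1 (funext fun k => by simpa using congr_fun h k)
  · rw [apply_ofReal, congr_fun hp.1.2 i]
    push_cast
    rfl
  · rw [Complex.norm_of_nonneg hp.2.1]
  · rintro _ ⟨mu, y, ⟨hy0, hyA⟩, rfl⟩
    -- By the triangle inequality the moduli of a complex eigenvector form a subeigenvector for
    -- `‖mu‖`.
    refine hA.le_of_subeigenvector (y := fun k => ‖y k‖)
      (hA.eigenvector_pos hm hirr hp.2.2.1 hp.1.1 (congr_fun hp.1.2)) (congr_fun hp.1.2)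
      (fun i => norm_nonneg _) ?_ fun i => ?_
    · intro h
      exact hy0 (funext fun k => by simpa using congr_fun h k)
    · rw [← norm_pow, ← norm_mul, ← congr_fun hyA i]
      exact hA.norm_apply_le y i

/-! ### A priori bounds, compactness and existence for positive tensors -/

/-- The eigenvalue of a nonnegative eigenvector is bounded by the sum of the entries. -/
theorem IsNonneg.eigenvalue_le_sum {A : RealTensor m n} (hA : A.IsNonneg) {lam : ℝ}
    {x : Fin n → ℝ} (hx : ∀ i, 0 ≤ x i) (hx0 : x ≠ 0)
    (hxA : ∀ i, A.apply x i = lam * x i ^ (m - 1)) : lam ≤ ∑ i, ∑ j, A i j := by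
  obtain ⟨s, i, hs, hi, hle⟩ := exists_max_ratio (x := fun _ => 1) (fun _ => one_pos) hx hx0
  simp only [mul_one] at hi hle
  have h1 := hA.apply_mono hx hle i
  rw [hxA, hi, apply_real] at h1
  simp only [Finset.prod_const, Finset.card_univ, Fintype.card_fin, ← Finset.sum_mul] at h1
  exact (le_of_mul_le_mul_right h1 (pow_pos hs _)).trans
    (Finset.single_le_sum (f := fun i => ∑ j, A i j)
      (fun i _ => Finset.sum_nonneg fun j _ => hA i j) (Finset.mem_univ i))

theorem contDiff_apply (A : RealTensor m n) (i : Fin n) :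
    ContDiff ℝ ∞ fun x : Fin n → ℝ => A.apply x i := by
  simp only [apply_real]
  fun_prop

theorem continuous_apply' (A : RealTensor m n) (i : Fin n) :
    Continuous fun x : Fin n → ℝ => A.apply x i :=
  (A.contDiff_apply i).continuous

theorem le_one_of_dotProduct_eq_one {x : Fin n → ℝ} (hx : x ⬝ᵥ x = 1) (i : Fin n) : x i ≤ 1 := by
  have h : x i * x i ≤ x ⬝ᵥ x :=
    Finset.single_le_sum (f := fun i => x i * x i) (fun i _ => mul_self_nonneg _)
      (Finset.mem_univ i)
  nlinarith

theorem exists_pos_normalize {x : Fin n → ℝ} (hx0 : x ≠ 0) :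
    ∃ c : ℝ, 0 < c ∧ (c • x) ⬝ᵥ (c • x) = 1 := by
  have h : 0 < x ⬝ᵥ x :=
    lt_of_le_of_ne (Finset.sum_nonneg fun i _ => mul_self_nonneg _)
      (fun h => hx0 (dotProduct_self_eq_zero.1 h.symm))
  refine ⟨(Real.sqrt (x ⬝ᵥ x))⁻¹, by positivity, ?_⟩
  rw [smul_dotProduct, dotProduct_smul, smul_eq_mul, smul_eq_mul, ← mul_assoc, ← mul_inv,
    Real.mul_self_sqrt h.le, inv_mul_cancel₀ h.ne']

/-- Serves twice: for the minimization that yields an eigenpair, and for the limit points of the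
curve. -/
theorem isCompact_nonneg_unit (M : ℝ) :
    IsCompact {p : ℝ × (Fin n → ℝ) | 0 ≤ p.1 ∧ p.1 ≤ M ∧ (∀ i, 0 ≤ p.2 i) ∧ p.2 ⬝ᵥ p.2 = 1} := by
  refine IsCompact.of_isClosed_subset (isCompact_Icc (a := ((0 : ℝ), (0 : Fin n → ℝ)))
    (b := (M, fun _ => 1))) ?_ ?_
  · simp only [Set.ofPred_and, Set.ofPred_forall]
    refine (isClosed_le (by fun_prop) (by fun_prop)).inter
      ((isClosed_le (by fun_prop) (by fun_prop)).inter
      ((isClosed_iInter fun i => isClosed_le (by fun_prop) (by fun_prop)).inter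
      (isClosed_eq ?_ (by fun_prop))))
    simp only [dotProduct]
    fun_prop
  · rintro ⟨lam, x⟩ ⟨h1, h2, h3, h4⟩
    exact ⟨⟨h1, h3⟩, ⟨h2, fun i => le_one_of_dotProduct_eq_one h4 i⟩⟩

/-- A tensor with positive entries has a positive unit eigenvector with positive eigenvalue. -/
theorem exists_pos_unit_eigenpair {B : RealTensor m n} (hm : 2 ≤ m) (hn : 1 ≤ n)
    (hB : ∀ i j, 0 < B i j) : ∃ (lam : ℝ) (x : Fin n → ℝ), 0 < lam ∧ (∀ i, 0 < x i) ∧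
      x ⬝ᵥ x = 1 ∧ ∀ i, B.apply x i = lam * x i ^ (m - 1) := by
  have hm0 : m - 1 ≠ 0 := by omega
  have hB0 : B.IsNonneg := fun i j => (hB i j).le
  set M : ℝ := ∑ i, ∑ j, B i j
  have hrow (i : Fin n) : ∑ j, B i j ≤ M :=
    Finset.single_le_sum (f := fun i => ∑ j, B i j)
      (fun i _ => Finset.sum_nonneg fun j _ => hB0 i j) (Finset.mem_univ i)
  have hM : 0 ≤ M := Finset.sum_nonneg fun i _ => Finset.sum_nonneg fun j _ => hB0 i j
  -- Collatz–Wielandt: minimize `lam` over unit supersolutions. The cap `M` gives compactness and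
  -- still admits the normalized all-ones vector, since row sums are at most `M`.
  let S : Set (ℝ × (Fin n → ℝ)) :=
    {p | 0 ≤ p.1 ∧ p.1 ≤ M ∧ (∀ i, 0 ≤ p.2 i) ∧ p.2 ⬝ᵥ p.2 = 1} ∩
      {p | ∀ i, B.apply p.2 i ≤ p.1 * p.2 i ^ (m - 1)}
  have hscale {lam : ℝ} {x : Fin n → ℝ} (h0 : 0 ≤ lam) (h1 : lam ≤ M) (hx : ∀ i, 0 ≤ x i)
      (hx0 : x ≠ 0) (hxB : ∀ i, B.apply x i ≤ lam * x i ^ (m - 1)) :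
      ∃ c : ℝ, (lam, c • x) ∈ S := by
    obtain ⟨c, hc, hc1⟩ := exists_pos_normalize hx0
    refine ⟨c, ⟨h0, h1, fun i => mul_nonneg hc.le (hx i), hc1⟩, fun i => ?_⟩
    change B.apply (c • x) i ≤ lam * (c * x i) ^ (m - 1)
    rw [apply_smul, mul_pow, mul_left_comm]
    exact mul_le_mul_of_nonneg_left (hxB i) (by positivity)
  have hS : IsCompact S := by
    refine (isCompact_nonneg_unit M).inter_right ?_
    simp only [Set.ofPred_forall]
    exact isClosed_iInter fun i => isClosed_le
      ((B.continuous_apply' i).comp continuous_snd) (by fun_prop)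
  have hne : S.Nonempty := by
    obtain ⟨c, hc⟩ := hscale hM le_rfl (x := fun _ => 1) (fun _ => zero_le_one)
      (fun h => one_ne_zero (congr_fun h ⟨0, hn⟩)) fun i => by
        simpa [apply_real] using hrow i
    exact ⟨_, hc⟩
  obtain ⟨⟨lam, x⟩, hmem, hmin⟩ := hS.exists_isMinOn hne (f := Prod.fst) continuous_fst.continuousOn
  obtain ⟨⟨h0, h1, hx, hx1⟩, hxB⟩ := hmem
  simp only [mem_ofPred_eq] at h0 h1 hx hx1 hxB
  have hx0 := ne_zero_of_dotProduct_eq_one hx1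
  have hpos := apply_pos hB hx hx0
  have hxpos (i : Fin n) : 0 < x i := by
    refine (hx i).lt_of_ne' fun h => ?_
    have h2 := (hpos i).trans_le (hxB i)
    rw [h, zero_pow hm0, mul_zero] at h2
    exact h2.false
  have hlam : 0 < lam := by
    refine h0.lt_of_ne' fun h => ?_
    have h2 := (hpos ⟨0, hn⟩).trans_le (hxB _)
    rw [h, zero_mul] at h2
    exact h2.false
  refine ⟨lam, x, hlam, hxpos, hx1, ?_⟩
  -- One step of the power iteration: `lam z^{[m-1]} = B x^{m-1}`, hence `z ≤ x`. If `z ≠ x`, strict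
  -- monotonicity gives `B z^{m-1} < B x^{m-1} = lam z^{[m-1]}` in every entry, so `z` is a
  -- supersolution for a value below the minimum.
  let z : Fin n → ℝ := fun i => (B.apply x i / lam) ^ ((m - 1 : ℕ) : ℝ)⁻¹
  have hzpos (i : Fin n) : 0 < z i := Real.rpow_pos_of_pos (div_pos (hpos i) hlam) _
  have hzpow (i : Fin n) : z i ^ (m - 1) = B.apply x i / lam :=
    Real.rpow_inv_natCast_pow (div_pos (hpos i) hlam).le hm0
  have hzx (i : Fin n) : z i ≤ x i := by
    refine le_of_pow_le_pow_left₀ hm0 (hx i) ?_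
    rw [hzpow, div_le_iff₀ hlam, mul_comm]
    exact hxB i
  by_cases hzeq : z = x
  · intro i
    rw [← congr_fun hzeq i, hzpow, mul_div_cancel₀ _ hlam.ne']
  · exfalso
    have hlt (i : Fin n) : B.apply z i / z i ^ (m - 1) < lam := by
      rw [div_lt_iff₀ (pow_pos (hzpos i) _), hzpow, mul_div_cancel₀ _ hlam.ne']
      exact apply_strictMono hm hB (fun i => (hzpos i).le) hzx hzeq i
    obtain ⟨l, -, hl⟩ := Finset.exists_max_image Finset.univ
      (fun i => B.apply z i / z i ^ (m - 1)) ⟨⟨0, hn⟩, Finset.mem_univ _⟩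
    obtain ⟨c, hc⟩ := hscale (lam := B.apply z l / z l ^ (m - 1)) (x := z)
      (div_nonneg (hB0.apply_nonneg (fun i => (hzpos i).le) l) (pow_pos (hzpos l) _).le)
      ((hlt l).le.trans h1) (fun i => (hzpos i).le)
      (fun h => (hzpos ⟨0, hn⟩).ne' (congr_fun h _))
      fun i => (div_le_iff₀ (pow_pos (hzpos i) _)).1 (hl i (Finset.mem_univ _))
    exact (hlt l).not_ge (hmin hc)

/-! ### Nondegeneracy of the linearized system -/

/-- The derivative of `x ↦ A x^{m-1}` in the direction with entries `x_i w_i`. -/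
theorem hasDerivAt_apply_smul_add (B : RealTensor m n) (x w : Fin n → ℝ) (i : Fin n) :
    HasDerivAt (fun s : ℝ => B.apply (x + s • (x * w)) i)
      (∑ j : Fin (m - 1) → Fin n, B i j * (∏ k, x (j k)) * ∑ k, w (j k)) 0 := by
  simp only [apply_real]
  -- In the direction `x * w` the factor `∏ x (j k)` splits off, leaving this product to
  -- differentiate.
  have h (j : Fin (m - 1) → Fin n) :
      HasDerivAt (fun s : ℝ => ∏ k, (1 + s * w (j k))) (∑ k, w (j k)) 0 := by
    have := HasDerivAt.fun_finsetProd (u := Finset.univ) (x := (0 : ℝ))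
      (f := fun (k : Fin (m - 1)) (s : ℝ) => 1 + s * w (j k)) (f' := fun k => w (j k))
      fun k _ => by simpa using ((hasDerivAt_id (0 : ℝ)).mul_const (w (j k))).const_add 1
    simpa using this
  have h2 (s : ℝ) (j : Fin (m - 1) → Fin n) : B i j * ∏ k, (x + s • (x * w)) (j k) =
      B i j * (∏ k, x (j k)) * ∏ k, (1 + s * w (j k)) := by
    rw [mul_assoc, ← Finset.prod_mul_distrib]
    congr 1
    exact Finset.prod_congr rfl fun k _ => by simp; ring
  simp only [h2]
  exact HasDerivAt.fun_sum fun j _ => (h j).const_mul _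

/-- The linearized eigenvalue system of a tensor with positive entries at a positive unit
eigenpair has only the trivial solution. -/
theorem linearized_eigenSystem_injective {B : RealTensor m n} (hm : 2 ≤ m) (hn : 1 ≤ n)
    (hB : ∀ i j, 0 < B i j) {lam : ℝ} {x : Fin n → ℝ} (hx : ∀ i, 0 < x i)
    (hx1 : x ⬝ᵥ x = 1) (hxB : ∀ i, B.apply x i = lam * x i ^ (m - 1)) {mu : ℝ} {w : Fin n → ℝ}
    (h1 : ∀ i, ∑ j : Fin (m - 1) → Fin n, B i j * (∏ k, x (j k)) * ∑ k, w (j k) =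
      mu * x i ^ (m - 1) + lam * x i ^ (m - 1) * ((m - 1 : ℕ) * w i))
    (h2 : x ⬝ᵥ (x * w) = 0) : mu = 0 ∧ w = 0 := by
  have hm0 : m - 1 ≠ 0 := by omega
  have hP (i : Fin n) (j : Fin (m - 1) → Fin n) : 0 < B i j * ∏ k, x (j k) :=
    mul_pos (hB i j) (Finset.prod_pos fun k _ => hx (j k))
  -- The eigenvalue equation absorbs the `lam` term into differences of `w`. At a maximum of `w`
  -- they are nonpositive, at a minimum nonnegative, so `mu = 0`. Then all terms vanish at the
  -- maximum, and constant tuples show that `w` is constant; normalization makes it zero.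
  have key (i : Fin n) : ∑ j : Fin (m - 1) → Fin n,
      B i j * (∏ k, x (j k)) * ∑ k, (w (j k) - w i) = mu * x i ^ (m - 1) := by
    have h3 := h1 i
    rw [← hxB i, apply_real, Finset.sum_mul, ← sub_eq_iff_eq_add, ← Finset.sum_sub_distrib] at h3
    rw [← h3]
    refine Finset.sum_congr rfl fun j _ => ?_
    rw [Finset.sum_sub_distrib, Finset.sum_const, Finset.card_univ, Fintype.card_fin, nsmul_eq_mul]
    ring
  obtain ⟨i, -, hi⟩ := Finset.exists_max_image Finset.univ w ⟨⟨0, hn⟩, Finset.mem_univ _⟩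
  obtain ⟨l, -, hl⟩ := Finset.exists_min_image Finset.univ w ⟨⟨0, hn⟩, Finset.mem_univ _⟩
  have hterm (j : Fin (m - 1) → Fin n) :
      B i j * (∏ k, x (j k)) * ∑ k, (w (j k) - w i) ≤ 0 :=
    mul_nonpos_of_nonneg_of_nonpos (hP i j).le
      (Finset.sum_nonpos fun k _ => sub_nonpos.2 (hi _ (Finset.mem_univ _)))
  have hle : mu * x i ^ (m - 1) ≤ 0 := by
    rw [← key i]
    exact Finset.sum_nonpos fun j _ => hterm j
  have hge : 0 ≤ mu * x l ^ (m - 1) := by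
    rw [← key l]
    exact Finset.sum_nonneg fun j _ => mul_nonneg (hP l j).le
      (Finset.sum_nonneg fun k _ => sub_nonneg.2 (hl _ (Finset.mem_univ _)))
  have hmu : mu = 0 := le_antisymm (nonpos_of_mul_nonpos_left hle (pow_pos (hx i) _))
    (nonneg_of_mul_nonneg_left hge (pow_pos (hx l) _))
  have hconst (k : Fin n) : w k = w i := by
    have h3 := key i
    rw [hmu, zero_mul] at h3
    have h4 := (Finset.sum_eq_zero_iff_of_nonpos fun j _ => hterm j).1 h3 (fun _ => k)
      (Finset.mem_univ _)
    have h5 := (mul_eq_zero.1 h4).resolve_left (hP i _).ne'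
    rw [Finset.sum_const, Finset.card_univ, Fintype.card_fin, smul_eq_zero] at h5
    exact sub_eq_zero.1 (h5.resolve_left hm0)
  have hw : x * w = w i • x := funext fun k => by
    rw [Pi.mul_apply, hconst k, Pi.smul_apply, smul_eq_mul, mul_comm]
  rw [hw, dotProduct_smul, hx1, smul_eq_mul, mul_one] at h2
  exact ⟨hmu, funext fun k => (hconst k).trans h2⟩

/-! ### The homotopy as a family of positive tensors -/

/-- The convex combination of the start tensor and `A` whose eigenvalue system is the homotopy. -/
def blend (A : RealTensor m n) (a b : Fin n → ℝ) (t : ℝ) : RealTensor m n :=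
  fun i j => (1 - t) * start m a b i j + t * A i j

theorem start_pos {a b : Fin n → ℝ} (ha : ∀ i, 0 < a i) (hb : ∀ i, 0 < b i) (i : Fin n)
    (j : Fin (m - 1) → Fin n) : 0 < start m a b i j :=
  mul_pos (pow_pos (ha i) _) (Finset.prod_pos fun k _ => hb (j k))

theorem IsNonneg.blend_pos {A : RealTensor m n} (hA : A.IsNonneg) {a b : Fin n → ℝ}
    (ha : ∀ i, 0 < a i) (hb : ∀ i, 0 < b i) {t : ℝ} (ht : t ∈ Ico (0 : ℝ) 1) (i : Fin n)
    (j : Fin (m - 1) → Fin n) : 0 < A.blend a b t i j :=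
  add_pos_of_pos_of_nonneg (mul_pos (sub_pos.2 ht.2) (start_pos ha hb i j))
    (mul_nonneg ht.1 (hA i j))

theorem blend_apply (A : RealTensor m n) (a b : Fin n → ℝ) (t : ℝ) (x : Fin n → ℝ) (i : Fin n) :
    (A.blend a b t).apply x i = (1 - t) * (start m a b).apply x i + t * A.apply x i := by
  simp only [apply_real, blend, Finset.mul_sum, ← Finset.sum_add_distrib]
  exact Finset.sum_congr rfl fun j _ => by ring

/-- The parts that do not involve the tensor occur with weights `1 - t` and `t`, which sum to one.
-/
theorem homotopy_eq (A : RealTensor m n) (a b : Fin n → ℝ) (t : ℝ) (p : ℝ × (Fin n → ℝ)) :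
    A.homotopy a b p t = (A.blend a b t).eigenSystem p := by
  refine Prod.ext (funext fun i => ?_) ?_
  · simp only [homotopy, eigenSystem, Prod.fst_add, Prod.smul_fst, Pi.add_apply, Pi.smul_apply,
      smul_eq_mul, blend_apply]
    ring
  · simp only [homotopy, eigenSystem, Prod.snd_add, Prod.smul_snd, smul_eq_mul]
    ring

theorem eigenSystem_eq_zero_iff (A : RealTensor m n) (p : ℝ × (Fin n → ℝ)) :
    A.eigenSystem p = 0 ↔ (∀ i, A.apply p.2 i = p.1 * p.2 i ^ (m - 1)) ∧ p.2 ⬝ᵥ p.2 = 1 := by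
  simp only [eigenSystem, Prod.ext_iff, funext_iff, Prod.fst_zero, Prod.snd_zero, Pi.zero_apply,
    sub_eq_zero]

theorem isNonnegUnitEigenpair_iff (A : RealTensor m n) (p : ℝ × (Fin n → ℝ)) :
    A.IsNonnegUnitEigenpair p ↔ 0 ≤ p.1 ∧ (∀ i, 0 ≤ p.2 i) ∧ A.eigenSystem p = 0 := by
  rw [eigenSystem_eq_zero_iff]
  exact ⟨fun h => ⟨h.2.1, h.2.2.1, congr_fun h.1.2, h.2.2.2⟩,
    fun h => ⟨⟨ne_zero_of_dotProduct_eq_one h.2.2.2, funext h.2.2.1⟩, h.1, h.2.1, h.2.2.2⟩⟩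

theorem IsPositiveSolution.isNonnegUnitEigenpair {A : RealTensor m n} {a b : Fin n → ℝ} {t : ℝ}
    {p : ℝ × (Fin n → ℝ)} (hp : A.IsPositiveSolution a b t p) :
    (A.blend a b t).IsNonnegUnitEigenpair p :=
  (isNonnegUnitEigenpair_iff _ _).2
    ⟨hp.1.le, fun i => (hp.2.1 i).le, (A.homotopy_eq a b t p).symm.trans hp.2.2⟩

theorem IsNonneg.positiveSolution_unique {A : RealTensor m n} (hm : 2 ≤ m) (hA : A.IsNonneg)
    {a b : Fin n → ℝ} (ha : ∀ i, 0 < a i) (hb : ∀ i, 0 < b i) {t : ℝ} (ht : t ∈ Ico (0 : ℝ) 1)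
    {p q : ℝ × (Fin n → ℝ)} (hp : A.IsPositiveSolution a b t p)
    (hq : A.IsPositiveSolution a b t q) : p = q :=
  have hB := hA.blend_pos ha hb ht
  IsNonneg.unit_eigenpair_unique hm (fun i j => (hB i j).le) (not_isReducible_of_pos hB)
    hp.isNonnegUnitEigenpair hq.isNonnegUnitEigenpair

theorem IsNonneg.exists_positiveSolution {A : RealTensor m n} (hm : 2 ≤ m) (hn : 1 ≤ n)
    (hA : A.IsNonneg) {a b : Fin n → ℝ} (ha : ∀ i, 0 < a i) (hb : ∀ i, 0 < b i) {t : ℝ}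
    (ht : t ∈ Ico (0 : ℝ) 1) : ∃ p, A.IsPositiveSolution a b t p := by
  obtain ⟨lam, x, h0, hx, hx1, h⟩ := exists_pos_unit_eigenpair hm hn (hA.blend_pos ha hb ht)
  exact ⟨(lam, x), h0, hx, by rw [homotopy_eq, eigenSystem_eq_zero_iff]; exact ⟨h, hx1⟩⟩

theorem contDiff_eigenSystem (A : RealTensor m n) : ContDiff ℝ ∞ A.eigenSystem := by
  have h (i : Fin n) : ContDiff ℝ ∞ fun p : ℝ × (Fin n → ℝ) => A.apply p.2 i :=
    (A.contDiff_apply i).comp contDiff_snd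
  unfold eigenSystem dotProduct
  fun_prop

theorem contDiff_homotopy (A : RealTensor m n) (a b : Fin n → ℝ) :
    ContDiff ℝ ∞ fun q : ℝ × ℝ × (Fin n → ℝ) => A.homotopy a b q.2 q.1 := by
  have h1 := A.contDiff_eigenSystem
  have h2 := (start m a b).contDiff_eigenSystem
  unfold homotopy
  fun_prop

/-- The derivative of the eigenvalue system of a tensor with positive entries at a positive
unit eigenpair is injective. -/
theorem fderiv_eigenSystem_injective {B : RealTensor m n} (hm : 2 ≤ m) (hn : 1 ≤ n)
    (hB : ∀ i j, 0 < B i j) {p : ℝ × (Fin n → ℝ)} (hx : ∀ i, 0 < p.2 i)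
    (hp : B.eigenSystem p = 0) : Function.Injective (fderiv ℝ B.eigenSystem p) := by
  obtain ⟨lam, x⟩ := p
  rw [eigenSystem_eq_zero_iff] at hp
  obtain ⟨hxB, hx1⟩ := hp
  simp only at hx hxB hx1
  rw [injective_iff_map_eq_zero]
  rintro ⟨mu, v⟩ hd
  obtain ⟨w, rfl⟩ : ∃ w, v = x * w :=
    ⟨fun i => v i / x i, funext fun i => (mul_div_cancel₀ _ (hx i).ne').symm⟩
  have hline : HasDerivAt (fun s : ℝ => B.eigenSystem ((lam, x) + s • (mu, x * w)))
      ((0, 0) : (Fin n → ℝ) × ℝ) 0 := by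
    have h1 := (B.contDiff_eigenSystem.differentiable (by simp) (lam, x)).hasFDerivAt
    have h2 := h1.hasLineDerivAt (mu, x * w)
    rw [hd] at h2
    exact h2
  have hone : HasDerivAt (fun s : ℝ => lam + s * mu) mu 0 := by
    simpa using ((hasDerivAt_id (0 : ℝ)).mul_const mu).const_add lam
  have hfst (i : Fin n) : ∑ j : Fin (m - 1) → Fin n, B i j * (∏ k, x (j k)) * ∑ k, w (j k) =
      mu * x i ^ (m - 1) + lam * x i ^ (m - 1) * ((m - 1 : ℕ) * w i) := by
    have h1 : HasDerivAt (fun s : ℝ => B.apply (x + s • (x * w)) i -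
        (lam + s * mu) * (x i + s * (x i * w i)) ^ (m - 1)) 0 0 :=
      hasDerivAt_pi.1 (hasFDerivAt_fst.comp_hasDerivAt (0 : ℝ) hline) i
    have h2 : HasDerivAt (fun s : ℝ => (1 + s * w i) ^ (m - 1)) ((m - 1 : ℕ) * w i) 0 := by
      have h3 : HasDerivAt (fun s : ℝ => 1 + s * w i) (w i) 0 := by
        simpa using ((hasDerivAt_id (0 : ℝ)).mul_const (w i)).const_add 1
      simpa using h3.fun_pow (m - 1)
    have h4 := (hasDerivAt_apply_smul_add B x w i).sub (hone.mul (h2.const_mul (x i ^ (m - 1))))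
    have h5 := h1.unique (h4.congr_of_eventuallyEq (Eventually.of_forall fun s => by
      simp only [Pi.sub_apply, Pi.mul_apply]
      rw [← mul_pow]
      ring))
    simp only [zero_mul, add_zero, one_pow, mul_one] at h5
    linarith
  have hsnd : x ⬝ᵥ (x * w) = 0 := by
    have h1 : HasDerivAt (fun s : ℝ => (x + s • (x * w)) ⬝ᵥ (x + s • (x * w)) - 1) 0 0 :=
      (hasFDerivAt_snd (𝕜 := ℝ) (E := Fin n → ℝ) (F := ℝ)).comp_hasDerivAt (0 : ℝ) hline
    have h2 : HasDerivAt (fun s : ℝ => x ⬝ᵥ x - 1 + s * (2 * (x ⬝ᵥ (x * w))) +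
        s ^ 2 * ((x * w) ⬝ᵥ (x * w))) (2 * (x ⬝ᵥ (x * w))) 0 := by
      simpa using (((hasDerivAt_id (0 : ℝ)).mul_const (2 * (x ⬝ᵥ (x * w)))).const_add
        (x ⬝ᵥ x - 1)).fun_add (((hasDerivAt_id (0 : ℝ)).fun_pow 2).mul_const ((x * w) ⬝ᵥ (x * w)))
    have h3 := h1.unique (h2.congr_of_eventuallyEq (Eventually.of_forall fun s => by
      simp only [add_dotProduct, dotProduct_add, smul_dotProduct, dotProduct_smul, smul_eq_mul]
      rw [dotProduct_comm (x * w) x]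
      ring))
    linarith
  obtain ⟨rfl, rfl⟩ := linearized_eigenSystem_injective hm hn hB hx hx1 hxB hfst hsnd
  simp

/-! ### Smoothness by the implicit function theorem -/

/-- A curve of positive solutions of the homotopy is smooth. -/
theorem IsNonneg.contDiffOn_positiveSolution {A : RealTensor m n} (hm : 2 ≤ m) (hn : 1 ≤ n)
    (hA : A.IsNonneg) {a b : Fin n → ℝ} (ha : ∀ i, 0 < a i) (hb : ∀ i, 0 < b i)
    {p : ℝ → ℝ × (Fin n → ℝ)} (hp : ∀ t ∈ Ico (0 : ℝ) 1, A.IsPositiveSolution a b t (p t)) :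
    ContDiffOn ℝ ∞ p (Ico 0 1) := by
  intro t ht
  obtain ⟨hlam, hx, h0⟩ := hp t ht
  have hf : ContDiffAt ℝ ∞ (fun q : ℝ × ℝ × (Fin n → ℝ) => A.homotopy a b q.2 q.1) (t, p t) :=
    (A.contDiff_homotopy a b).contDiffAt
  have hpart : fderiv ℝ (fun q : ℝ × ℝ × (Fin n → ℝ) => A.homotopy a b q.2 q.1) (t, p t) ∘L
      .inr ℝ ℝ (ℝ × (Fin n → ℝ)) = fderiv ℝ (A.blend a b t).eigenSystem (p t) := by
    have h1 := (hf.differentiableAt (by simp)).hasFDerivAt.comp (p t)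
      (hasFDerivAt_prodMk_right t (p t))
    rw [← h1.fderiv]
    congr 1
    exact funext fun q => A.homotopy_eq a b t q
  have hinv : (fderiv ℝ (fun q : ℝ × ℝ × (Fin n → ℝ) => A.homotopy a b q.2 q.1) (t, p t) ∘L
      .inr ℝ ℝ (ℝ × (Fin n → ℝ))).IsInvertible := by
    rw [hpart]
    -- Injectivity suffices: domain and codomain both have dimension `n + 1`.
    have hinj := fderiv_eigenSystem_injective hm hn (hA.blend_pos ha hb ht) hx
      ((A.homotopy_eq a b t (p t)).symm.trans h0)
    exact ⟨(LinearEquiv.ofInjectiveOfFinrankEq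
      (fderiv ℝ (A.blend a b t).eigenSystem (p t)).toLinearMap hinj
      (by simp [add_comm])).toContinuousLinearEquiv, by ext <;> rfl⟩
  have hne : (∞ : WithTop ℕ∞) ≠ 0 := by simp
  have hsmooth := hf.contDiffAt_implicitFunction hne hinv
  have hself := hf.implicitFunction_apply_self hne hinv
  have hsol := hf.eventually_apply_implicitFunction hne hinv
  set ψ := hf.implicitFunction hne hinv
  simp only at hsmooth hself hsol
  have hcont : Tendsto ψ (𝓝 t) (𝓝 (p t)) := by
    have := hsmooth.continuousAt.tendsto
    rwa [hself] at this
  -- `ψ` is smooth on a full neighbourhood of `t`, even for `t = 0`. Near `t` it stays positive by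
  -- continuity, so uniqueness identifies it with `p` within `Ico 0 1`.
  refine hsmooth.contDiffWithinAt.congr_of_eventuallyEq_of_mem ?_ ht
  have hposlam : ∀ᶠ s in 𝓝 t, 0 < (ψ s).1 :=
    (continuous_fst.continuousAt.tendsto.comp hcont).eventually (lt_mem_nhds hlam)
  have hposx : ∀ᶠ s in 𝓝 t, ∀ i, 0 < (ψ s).2 i := by
    rw [eventually_all]
    intro i
    exact ((by fun_prop : Continuous fun q : ℝ × (Fin n → ℝ) => q.2 i).continuousAt.tendsto.comp
      hcont).eventually (lt_mem_nhds (hx i))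
  filter_upwards [self_mem_nhdsWithin, nhdsWithin_le_nhds hposlam, nhdsWithin_le_nhds hposx,
    nhdsWithin_le_nhds hsol] with s hs h1 h2 h3
  exact hA.positiveSolution_unique hm ha hb hs (hp s hs) ⟨h1, h2, h3.trans h0⟩

/-! ### The two ends of the curve -/

/-- Expanding the power of `b ⬝ᵥ x` over tuples gives the sum. The image is always a multiple of
`a^{[m-1]}`, which is why `a` is the eigenvector. -/
theorem start_apply (a b x : Fin n → ℝ) (i : Fin n) :
    (start m a b).apply x i = a i ^ (m - 1) * (b ⬝ᵥ x) ^ (m - 1) := by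
  simp only [apply_real, start, mul_assoc, ← Finset.mul_sum, ← Finset.prod_mul_distrib]
  rw [dotProduct, Finset.sum_pow']
  simp

/-- The explicit positive solution of the homotopy at `t = 0`. -/
theorem isPositiveSolution_zero (hn : 1 ≤ n) (A : RealTensor m n) {a b : Fin n → ℝ}
    (ha : ∀ i, 0 < a i) (hb : ∀ i, 0 < b i) :
    A.IsPositiveSolution a b 0 ((a ⬝ᵥ b) ^ (m - 1), (Real.sqrt (a ⬝ᵥ a))⁻¹ • a) := by
  have hne : (Finset.univ : Finset (Fin n)).Nonempty := ⟨⟨0, hn⟩, Finset.mem_univ _⟩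
  have haa : 0 < a ⬝ᵥ a := Finset.sum_pos (fun i _ => mul_pos (ha i) (ha i)) hne
  have hab : 0 < a ⬝ᵥ b := Finset.sum_pos (fun i _ => mul_pos (ha i) (hb i)) hne
  have hc : 0 < (Real.sqrt (a ⬝ᵥ a))⁻¹ := by positivity
  refine ⟨pow_pos hab _, fun i => mul_pos hc (ha i), ?_⟩
  rw [homotopy_eq, eigenSystem_eq_zero_iff]
  refine ⟨fun i => ?_, ?_⟩
  · simp only [blend_apply, start_apply, dotProduct_smul, dotProduct_comm b a, Pi.smul_apply,
      smul_eq_mul, mul_pow]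
    ring
  · simp only [smul_dotProduct, dotProduct_smul, smul_eq_mul]
    rw [← mul_assoc, ← mul_inv, Real.mul_self_sqrt haa.le, inv_mul_cancel₀ haa.ne']

/-- Positive solutions of the homotopy stay in a compact set. -/
theorem IsNonneg.positiveSolution_bounded {A : RealTensor m n} (hA : A.IsNonneg)
    {a b : Fin n → ℝ} (ha : ∀ i, 0 < a i) (hb : ∀ i, 0 < b i) {t : ℝ} (ht : t ∈ Ico (0 : ℝ) 1)
    {p : ℝ × (Fin n → ℝ)} (hp : A.IsPositiveSolution a b t p) :
    0 ≤ p.1 ∧ p.1 ≤ ∑ i, ∑ j, (start m a b i j + A i j) ∧ (∀ i, 0 ≤ p.2 i) ∧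
      p.2 ⬝ᵥ p.2 = 1 := by
  have h := hp.isNonnegUnitEigenpair
  have hB : (A.blend a b t).IsNonneg := fun i j => (hA.blend_pos ha hb ht i j).le
  refine ⟨h.2.1, (hB.eigenvalue_le_sum h.2.2.1 h.1.1 (congr_fun h.1.2)).trans ?_, h.2.2⟩
  refine Finset.sum_le_sum fun i _ => Finset.sum_le_sum fun j _ => add_le_add ?_ ?_
  · exact mul_le_of_le_one_left (start_pos ha hb i j).le (by linarith [ht.1])
  · exact mul_le_of_le_one_left (hA i j) ht.2.le

theorem homotopy_one (A : RealTensor m n) (a b : Fin n → ℝ) (p : ℝ × (Fin n → ℝ)) :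
    A.homotopy a b p 1 = A.eigenSystem p := by
  simp [homotopy]

/-- Limit points of a curve of positive solutions are nonnegative unit eigenpairs. -/
theorem isNonnegUnitEigenpair_of_mapClusterPt {A : RealTensor m n} {a b : Fin n → ℝ}
    {p : ℝ → ℝ × (Fin n → ℝ)} (hp : ∀ t ∈ Ico (0 : ℝ) 1, A.IsPositiveSolution a b t (p t))
    {q : ℝ × (Fin n → ℝ)} (hq : MapClusterPt q (𝓝[<] (1 : ℝ)) p) :
    A.IsNonnegUnitEigenpair q := by
  -- Along an ultrafilter the cluster point becomes a genuine limit, so the closed conditions and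
  -- the equation pass to it.
  obtain ⟨U, hU, hUq⟩ := mapClusterPt_iff_ultrafilter.1 hq
  have hev : ∀ᶠ t in (U : Filter ℝ), A.IsPositiveSolution a b t (p t) := by
    filter_upwards [hU (Ico_mem_nhdsLT zero_lt_one)] with t ht using hp t ht
  have hU1 : Tendsto (fun t : ℝ => (t, p t)) U (𝓝 (1, q)) :=
    (tendsto_id.mono_left (hU.trans nhdsWithin_le_nhds)).prodMk_nhds hUq
  have hlim := ((A.contDiff_homotopy a b).continuous.tendsto (1, q)).comp hU1
  rw [isNonnegUnitEigenpair_iff, ← A.homotopy_one a b]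
  refine ⟨ge_of_tendsto ((continuous_fst.tendsto q).comp hUq) (hev.mono fun t ht => ht.1.le),
    fun i => ge_of_tendsto
      (((by fun_prop : Continuous fun q : ℝ × (Fin n → ℝ) => q.2 i).tendsto q).comp hUq)
      (hev.mono fun t ht => (ht.2.1 i).le), ?_⟩
  exact tendsto_nhds_unique hlim (tendsto_const_nhds.congr' (hev.mono fun t ht => ht.2.2.symm))

end RealTensor

/-! ### Assembly of the theorem -/

theorem theorem2p1 {m n : ℕ} (hm : 2 ≤ m) (hn : 1 ≤ n)
    (A : RealTensor m n) (hA : A.IsNonneg)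
    (a b : Fin n → ℝ) (ha : ∀ i, 0 < a i) (hb : ∀ i, 0 < b i) :
    -- the positive solution curve exists and is unique
    (∀ t ∈ Ico (0 : ℝ) 1, ∃! p : ℝ × (Fin n → ℝ), A.IsPositiveSolution a b t p) ∧
    ∀ (lam : ℝ → ℝ) (x : ℝ → Fin n → ℝ),
      (∀ t ∈ Ico (0 : ℝ) 1, A.IsPositiveSolution a b t (lam t, x t)) →
      -- it is a smooth curve that starts at the Perron pair of the start tensor
      ContDiffOn ℝ ∞ (fun t => (lam t, x t)) (Ico 0 1) ∧
      lam 0 = (a ⬝ᵥ b) ^ (m - 1) ∧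
      x 0 = (Real.sqrt (a ⬝ᵥ a))⁻¹ • a ∧
      (RealTensor.start m a b).IsPerronPair (lam 0, x 0) ∧
      (∀ q, (RealTensor.start m a b).IsPerronPair q → q = (lam 0, x 0)) ∧
      -- limit points as `t → 1` exist, and each is a nonnegative normalized eigenpair
      (∃ p, MapClusterPt p (𝓝[<] (1 : ℝ)) (fun t => (lam t, x t))) ∧
      (∀ p, MapClusterPt p (𝓝[<] (1 : ℝ)) (fun t => (lam t, x t)) →
        A.IsNonnegUnitEigenpair p) ∧
      -- in the irreducible case the curve converges to the Perron pair
      (¬ A.IsReducible →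
        ∃ p, A.IsPerronPair p ∧ (∀ q, A.IsPerronPair q → q = p) ∧
          Tendsto (fun t => (lam t, x t)) (𝓝[<] (1 : ℝ)) (𝓝 p)) := by
  refine ⟨fun t ht => ?_, fun lam x hsol => ?_⟩
  · obtain ⟨p, hp⟩ := hA.exists_positiveSolution hm hn ha hb ht
    exact ⟨p, hp, fun q hq => hA.positiveSolution_unique hm ha hb ht hq hp⟩
  have h0 : (0 : ℝ) ∈ Ico (0 : ℝ) 1 := ⟨le_rfl, zero_lt_one⟩
  have hstart := hA.positiveSolution_unique hm ha hb h0 (hsol 0 h0)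
    (A.isPositiveSolution_zero hn ha hb)
  have hblend : A.blend a b 0 = RealTensor.start m a b := by
    funext i j
    simp [RealTensor.blend]
  have hE : (RealTensor.start m a b).IsNonnegUnitEigenpair (lam 0, x 0) :=
    hblend ▸ (hsol 0 h0).isNonnegUnitEigenpair
  have hE0 : (RealTensor.start m a b).IsNonneg := fun i j => (RealTensor.start_pos ha hb i j).le
  have hEirr : ¬ (RealTensor.start m a b).IsReducible :=
    RealTensor.not_isReducible_of_pos (RealTensor.start_pos ha hb)
  have hcomp := RealTensor.isCompact_nonneg_unit (n := n)
    (∑ i, ∑ j, (RealTensor.start m a b i j + A i j))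
  have hmem : ∀ᶠ t in 𝓝[<] (1 : ℝ), (lam t, x t) ∈ {p : ℝ × (Fin n → ℝ) |
      0 ≤ p.1 ∧ p.1 ≤ ∑ i, ∑ j, (RealTensor.start m a b i j + A i j) ∧ (∀ i, 0 ≤ p.2 i) ∧
        p.2 ⬝ᵥ p.2 = 1} := by
    filter_upwards [Ico_mem_nhdsLT zero_lt_one] with t ht
    exact hA.positiveSolution_bounded ha hb ht (hsol t ht)
  have hex : ∃ p, MapClusterPt p (𝓝[<] (1 : ℝ)) (fun t => (lam t, x t)) := by
    obtain ⟨p, -, hp⟩ := hcomp.exists_clusterPt (tendsto_principal.2 hmem)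
    exact ⟨p, hp⟩
  have hlim (p) (hp : MapClusterPt p (𝓝[<] (1 : ℝ)) (fun t => (lam t, x t))) :
      A.IsNonnegUnitEigenpair p := RealTensor.isNonnegUnitEigenpair_of_mapClusterPt hsol hp
  refine ⟨hA.contDiffOn_positiveSolution hm hn ha hb hsol, congrArg Prod.fst hstart,
    congrArg Prod.snd hstart, hE0.isPerronPair hm hEirr hE,
    fun q hq => hE0.unit_eigenpair_unique hm hEirr hq.2 hE, hex, hlim, fun hirr => ?_⟩
  obtain ⟨p, hp⟩ := hex
  refine ⟨p, hA.isPerronPair hm hirr (hlim p hp),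
    fun q hq => hA.unit_eigenpair_unique hm hirr hq.2 (hlim p hp), ?_⟩
  -- A curve that eventually stays in a compact set and has only one cluster point converges to it.
  exact hcomp.tendsto_nhds_of_unique_mapClusterPt hmem fun q _ hq =>
    hA.unit_eigenpair_unique hm hirr (hlim q hq) (hlim p hp)
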